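/- Let $F$ be a field of characteristic $0$ and let $L$ be a finite-dimensional left Leibniz algebra over $F$, that is, a finite-dimensional $F$-vector space with a bilinear product such that $a(xy) = (ax)y + x(ay)$ for all $a, x, y \in L$. Let $R$ be the soluble radical of $L$, that is, the sum of all soluble two-sided ideals of $L$ (which is the largest soluble ideal); here an ideal $I$ is soluble if its derived series $I^{(0)} = I$, $I^{(k+1)} = I^{(k)} I^{(k)}$ (the span of products) satisfies $I^{(k)} = 0$ for some $k$. Then there exists a subalgebra $S$ of $L$ which is semisimple (its own soluble radical is zero; in particular $S$ is a semisimple, possibly zero, Lie algebra) such that $S + R = L$ and $S \cap R = 0$. -/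

import Mathlib

/-- A left Leibniz algebra: a nonassociative algebra in which every left multiplication
`d_a : x ↦ a * x` is a derivation. -/
class IsLeftLeibniz (L : Type*) [NonUnitalNonAssocRing L] : Prop where
  leibniz : ∀ a x y : L, a * (x * y) = (a * x) * y + x * (a * y)

namespace Leibniz

section

variable {F L : Type*} [Field F] [NonUnitalNonAssocRing L] [Module F L]

/-- A subspace `I` is a (two-sided) ideal if `L * I ⊆ I` and `I * L ⊆ I`. -/
structure IsIdeal (I : Submodule F L) : Prop where
  mul_mem_left : ∀ a : L, ∀ x ∈ I, a * x ∈ I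
  mul_mem_right : ∀ a : L, ∀ x ∈ I, x * a ∈ I

/-- The subspace `I * I` spanned by all products of two elements of `I`. -/
def derivedSubspace (I : Submodule F L) : Submodule F L :=
  Submodule.span F {z | ∃ x ∈ I, ∃ y ∈ I, x * y = z}

/-- The derived series `I⁽⁰⁾ = I`, `I⁽ᵏ⁺¹⁾ = I⁽ᵏ⁾ * I⁽ᵏ⁾`. -/
def derivedSeries (I : Submodule F L) : ℕ → Submodule F L
  | 0 => I
  | k + 1 => derivedSubspace (derivedSeries I k)

/-- `I` is soluble if its derived series reaches zero. -/
def IsSoluble (I : Submodule F L) : Prop :=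
  ∃ k : ℕ, derivedSeries I k = ⊥

end

section

variable (F L : Type*) [Field F] [NonUnitalNonAssocRing L] [Module F L]

/-- The soluble radical: the sum of all soluble ideals. (In finite dimension it is the largest
soluble ideal.) -/
def radical : Submodule F L :=
  sSup {I : Submodule F L | IsIdeal I ∧ IsSoluble I}

/-- An algebra is semisimple if its soluble radical is zero. (For a Leibniz algebra this forces
all squares to vanish, so that it is a semisimple Lie algebra.) -/
def IsSemisimple : Prop :=
  radical F L = ⊥

end

end Leibniz

/-!
Write `R` for the radical of `L` and `p : L → Q = L / R` for the quotient map. Squares lie in `R`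
(`mul_self_mem_radical`), because the span of all squares is an ideal with zero multiplication; so
`Q` is a Lie algebra, and it has trivial radical (`exists_lieAlgebra_quotient_radical`). Cartan's
criterion and a Casimir element give Whitehead's first lemma for `Q`
(`LieModule.exists_eq_lie_of_cocycle`): every derivation of `Q` into a finite-dimensional module is
inner.

The complement is found by descending along the derived series of `R`, staying inside `L`
throughout. Suppose that a subalgebra `S` maps onto `Q` and meets `R` in `A = R⁽ᵏ⁾`, and put
`B = R⁽ᵏ⁺¹⁾`. A linear projection `π` of `S` onto `A` defines a cocycle `x ↦ [d_x, π]`, where `d_x`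
is left multiplication by `x`, with values in the maps from `S` to `A` that send `A` to `B`. Modulo
`B` and modulo the operators `d_a`, `a ∈ A`, this is a cocycle of `Q`, so `π` can be changed,
remaining the identity on `A` modulo `B`, such that every `[d_x, π]` is some `d_a` modulo `B`
(`exists_projection_leftMulCommutator`). This is used twice.

* Since `[d_a, π] = -d_a` modulo `B` for `a ∈ A`, the `x ∈ S` for which `[d_x, π]` vanishes modulo
  `B` form a subalgebra `S'` that still maps onto `Q`, and `C = S' ∩ A` consists of the `a ∈ A` with
  `a * S ⊆ B` (`exists_inf_ker_eq`).
* For `S'` and `C` all the operators `d_c` vanish modulo `B`, so there is a projection of `S'` onto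
  `C` that is equivariant modulo `B`. Its kernel modulo `B` is a subalgebra mapping onto `Q` and
  meeting `R` in `B` (`exists_inf_ker_eq_of_mul_mem`).

Only left multiplications enter, so the usual distinction between symmetric and antisymmetric
bimodules is not needed.
-/

/-! ### Whitehead's first lemma -/

section Whitehead

open Module LieAlgebra

variable {F Q V : Type*} [Field F] [LieRing Q] [LieAlgebra F Q]
  [AddCommGroup V] [Module F V] [LieRingModule Q V] [LieModule F Q V]

theorem lie_top_eq_top_of_isKilling [FiniteDimensional F Q] [IsKilling F Q] :
    ⁅(⊤ : LieIdeal F Q), (⊤ : LieIdeal F Q)⁆ = ⊤ := by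
  set D := ⁅(⊤ : LieIdeal F Q), (⊤ : LieIdeal F Q)⁆ with hD
  have hc := D.isCompl_killingCompl
  have hab : IsLieAbelian D.killingCompl := by
    rw [LieSubmodule.lie_abelian_iff_lie_self_eq_bot, eq_bot_iff, ← hc.inf_eq_bot]
    refine le_inf ?_ (LieSubmodule.lie_le_left _ _)
    exact LieSubmodule.mono_lie le_top le_top
  have := IsKilling.ideal_eq_bot_of_isLieAbelian D.killingCompl
  simpa [this] using hc.sup_eq_top

attribute [local instance 100] LieRing.ofAssociativeRing in
theorem isNilpotent_ad_of_isNilpotent_toEnd (hV : Function.Injective (LieModule.toEnd F Q V))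
    {x : Q} (hx : IsNilpotent (LieModule.toEnd F Q V x)) : IsNilpotent (ad F Q x) := by
  obtain ⟨n, hn⟩ := ad_nilpotent_of_nilpotent (R := F) hx
  refine ⟨n, LinearMap.ext fun y ↦ hV ?_⟩
  have key (m : ℕ) : LieModule.toEnd F Q V ((ad F Q x ^ m) y) =
      (ad F (End F V) (LieModule.toEnd F Q V x) ^ m) (LieModule.toEnd F Q V y) := by
    induction m with
    | zero => simp
    | succ m ih => rw [pow_succ', pow_succ', Module.End.mul_apply, Module.End.mul_apply, ← ih]; simp
  rw [key, hn]; simp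

/-- On an ideal meeting the kernel of the action trivially, the trace form of a finite-dimensional
module is nondegenerate: its radical there is an ideal with vanishing trace form, which is
soluble by Cartan's criterion. -/
theorem LieIdeal.restrict_traceForm_nondegenerate [CharZero F] [FiniteDimensional F Q]
    [HasTrivialRadical F Q] [FiniteDimensional F V] (I : LieIdeal F Q)
    (hI : I ⊓ LieModule.ker F Q V = ⊥) :
    ((LieModule.traceForm F Q V).restrict I.toSubmodule).Nondegenerate := by
  set t := LieModule.traceForm F Q V with ht
  let K : LieIdeal F Q := I ⊓
    InvariantForm.orthogonal t (LieModule.traceForm_lieInvariant F Q V) I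
  have hKI : K ≤ I := inf_le_left
  have hK : K = ⊥ := by
    have tf : LieModule.traceForm F K V = 0 := by
      ext ⟨x, hx⟩ ⟨y, hy⟩
      exact hy.2 x hx.1
    have nilp : LieModule.IsNilpotent (derivedSeries F K 1) V :=
      LieModule.isNilpotent_derivedSeries_of_traceForm_eq_zero tf
    have : LieRing.IsNilpotent (derivedSeries F K 1) := by
      rw [LieAlgebra.isNilpotent_iff_forall (R := F)]
      intro x
      refine isNilpotent_ad_of_isNilpotent_toEnd (V := V) ?_
        ((LieModule.isNilpotent_iff_forall' (R := F)).mp nilp x)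
      refine (injective_iff_map_eq_zero _).mpr fun y hy ↦ ?_
      have : ((y : K) : Q) ∈ I ⊓ LieModule.ker F Q V :=
        ⟨hKI y.1.2, (LieModule.mem_ker F Q V _).mpr fun m ↦ LinearMap.congr_fun hy m⟩
      rw [hI] at this
      exact Subtype.ext (Subtype.ext this)
    have sol : IsSolvable K := by
      obtain ⟨k, hk⟩ := IsSolvable.solvable F (derivedSeries F K 1)
      rw [LieIdeal.derivedSeries_eq_bot_iff] at hk
      refine IsSolvable.mk (R := F) (k := k + 1) ?_
      rwa [derivedSeries_def, derivedSeriesOfIdeal_add]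
    exact HasTrivialRadical.eq_bot_of_isSolvable K
  refine (LinearMap.IsSymm.isRefl ⟨fun x y ↦ LieModule.traceForm_comm F Q V x y⟩ :
    (t.restrict I.toSubmodule).IsRefl).nondegenerate_iff_separatingLeft.mpr fun x hx ↦ ?_
  have : (x : Q) ∈ K := ⟨x.2, fun y hy ↦ (LieModule.traceForm_comm F Q V _ _).trans (hx ⟨y, hy⟩)⟩
  rw [hK] at this
  exact Subtype.ext this

/-- The Casimir tensor of an ideal is invariant under the whole Lie algebra. -/
theorem LieIdeal.sum_dualBasis_lie_add_eq_zero (I : LieIdeal F Q)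
    {t : LinearMap.BilinForm F Q} (hinv : t.lieInvariant Q) (hsymm : t.IsSymm)
    (hnd : (t.restrict I.toSubmodule).Nondegenerate) {ι : Type*} [Fintype ι] [DecidableEq ι]
    {W : Type*} [AddCommGroup W] [Module F W]
    (b : Basis ι F I.toSubmodule) (β : Q →ₗ[F] Q →ₗ[F] W) (x : Q) :
    ∑ i, β ⁅x, (b i : Q)⁆ ((t.restrict I.toSubmodule).dualBasis hnd b i)
      + ∑ i, β (b i) ⁅x, ((t.restrict I.toSubmodule).dualBasis hnd b i : Q)⁆ = 0 := by
  set d := (t.restrict I.toSubmodule).dualBasis hnd b with hd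
  have hsym' : (t.restrict I.toSubmodule).IsSymm := ⟨fun x y ↦ hsymm.eq x y⟩
  have h1 (y : Q) (hy : y ∈ I) : y = ∑ j, t y (d j) • (b j : Q) := by
    have := b.sum_repr ⟨y, hy⟩
    rw [← LinearMap.BilinForm.dualBasis_dualBasis hnd hsym' b] at this
    simp_rw [LinearMap.BilinForm.dualBasis_repr_apply] at this
    rw [LinearMap.BilinForm.dualBasis_dualBasis hnd hsym' b] at this
    simpa using (congrArg Subtype.val this).symm
  have h2 (y : Q) (hy : y ∈ I) : y = ∑ j, t y (b j) • (d j : Q) := by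
    have := d.sum_repr ⟨y, hy⟩
    simp_rw [hd, LinearMap.BilinForm.dualBasis_repr_apply] at this
    simpa using (congrArg Subtype.val this).symm
  have e1 : ∑ i, β ⁅x, (b i : Q)⁆ (d i) = ∑ i, ∑ j, t ⁅x, (b i : Q)⁆ (d j) • β (b j) (d i) := by
    refine Finset.sum_congr rfl fun i _ ↦ ?_
    conv_lhs => rw [h1 ⁅x, (b i : Q)⁆ (I.lie_mem (b i).2)]
    simp
  have e2 : ∑ i, β (b i) ⁅x, (d i : Q)⁆ = ∑ i, ∑ j, t ⁅x, (d i : Q)⁆ (b j) • β (b i) (d j) := by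
    refine Finset.sum_congr rfl fun i _ ↦ ?_
    conv_lhs => rw [h2 ⁅x, (d i : Q)⁆ (I.lie_mem (d i).2)]
    simp
  rw [e1, e2, Finset.sum_comm, ← Finset.sum_add_distrib]
  refine Finset.sum_eq_zero fun i _ ↦ ?_
  rw [← Finset.sum_add_distrib]
  refine Finset.sum_eq_zero fun j _ ↦ ?_
  rw [← add_smul, hinv, hsymm.eq _ (b j : Q)]
  simp

/-- On an irreducible module, the Casimir element of an ideal complementary to the kernel of the
action commutes with the action, and is invertible since its trace is `dim I ≠ 0`. -/
theorem LieModule.exists_eq_lie_of_cocycle_of_isIrreducible [CharZero F] [FiniteDimensional F Q]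
    [HasTrivialRadical F Q] [FiniteDimensional F V]
    (hirr : ∀ N : LieSubmodule F Q V, N = ⊥ ∨ N = ⊤) (f : Q →ₗ[F] V)
    (hf : ∀ x y, f ⁅x, y⁆ = ⁅x, f y⁆ - ⁅y, f x⁆) : ∃ v, ∀ x, f x = ⁅x, v⁆ := by
  classical
  set I := (LieModule.ker F Q V).killingCompl with hIdef
  have hc := (LieModule.ker F Q V).isCompl_killingCompl
  rw [← hIdef] at hc
  by_cases hI : I = ⊥
  · -- The action is trivial, so the cocycle vanishes on `⁅Q, Q⁆ = Q`.
    have hker : LieModule.ker F Q V = ⊤ := by simpa [hI] using hc.sup_eq_top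
    have htriv (x : Q) (v : V) : ⁅x, v⁆ = 0 := by
      have : x ∈ LieModule.ker F Q V := hker ▸ LieSubmodule.mem_top x
      exact (LieModule.mem_ker F Q V x).mp this v
    have hle : ⁅(⊤ : LieIdeal F Q), (⊤ : LieIdeal F Q)⁆.toSubmodule ≤
        LinearMap.ker f := by
      rw [LieSubmodule.lieIdeal_oper_eq_linear_span, Submodule.span_le]
      rintro _ ⟨x, y, rfl⟩
      simp [hf, htriv]
    refine ⟨0, fun x ↦ ?_⟩
    rw [lie_zero]
    rw [lie_top_eq_top_of_isKilling] at hle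
    exact hle trivial
  set t := LieModule.traceForm F Q V with ht
  have hnd := I.restrict_traceForm_nondegenerate (V := V) hc.symm.inf_eq_bot
  let b := Module.finBasis F I.toSubmodule
  set d := (t.restrict I.toSubmodule).dualBasis hnd b with hd
  let c : V →ₗ[F] V := ∑ i, toEnd F Q V (b i) ∘ₗ toEnd F Q V (d i)
  have hcapp (v : V) : c v = ∑ i, ⁅(b i : Q), ⁅(d i : Q), v⁆⁆ := by simp [c]
  -- every cocycle `g` satisfies `c (g x) = ⁅x, ∑ i, ⁅b i, g (d i)⁆⁆`
  have key (g : Q →ₗ[F] V) (hg : ∀ x y, g ⁅x, y⁆ = ⁅x, g y⁆ - ⁅y, g x⁆) (x : Q) :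
      c (g x) = ⁅x, ∑ i, ⁅(b i : Q), g (d i)⁆⁆ := by
    have h0 := I.sum_dualBasis_lie_add_eq_zero (LieModule.traceForm_lieInvariant F Q V)
      ⟨fun x y ↦ LieModule.traceForm_comm F Q V x y⟩ hnd b
      ((LieModule.toEnd F Q V : Q →ₗ[F] V →ₗ[F] V).compl₂ g) x
    rw [← Finset.sum_add_distrib] at h0
    rw [hcapp, lie_sum, ← sub_eq_zero, ← neg_eq_zero, neg_sub, ← Finset.sum_sub_distrib, ← h0]
    refine Finset.sum_congr rfl fun i _ ↦ ?_
    simp only [LinearMap.compl₂_apply, LieHom.coe_toLinearMap, toEnd_apply_apply, hg, lie_sub]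
    rw [leibniz_lie x (b i : Q)]
    abel
  have hcomm (x : Q) (v : V) : c ⁅x, v⁆ = ⁅x, c v⁆ := by
    have := key ((toEnd F Q V : Q →ₗ[F] V →ₗ[F] V).flip v)
      (fun x y ↦ by simp) x
    simpa [hcapp] using this
  have htr : LinearMap.trace F V c ≠ 0 := by
    have h1 (i) : LinearMap.trace F V (toEnd F Q V (b i) ∘ₗ toEnd F Q V (d i)) = 1 := by
      rw [← LieModule.traceForm_apply_apply]
      have := LinearMap.BilinForm.apply_dualBasis_right (B := t.restrict I.toSubmodule) hnd
        ⟨fun x y ↦ LieModule.traceForm_comm F Q V x y⟩ b i i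
      simpa using this
    have h2 : LinearMap.trace F V c = (Module.finrank F I.toSubmodule : F) := by
      simp [c, h1]
    rw [h2, Nat.cast_ne_zero]
    exact fun h ↦ hI (by simpa using Submodule.finrank_eq_zero.mp h)
  have hinj : Function.Injective c := by
    let N : LieSubmodule F Q V :=
      { LinearMap.ker c with
        lie_mem := fun {x m} hm ↦ by
          have hm' : c m = 0 := hm
          change c ⁅x, m⁆ = 0
          rw [hcomm, hm', lie_zero] }
    rcases hirr N with h | h
    · refine (injective_iff_map_eq_zero c).mpr fun v hv ↦ ?_
      have : v ∈ N := hv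
      rwa [h] at this
    · refine absurd ?_ htr
      have : c = 0 := LinearMap.ext fun v ↦ by
        have : v ∈ N := h ▸ LieSubmodule.mem_top v
        exact this
      rw [this, map_zero]
  obtain ⟨v, hv⟩ := LinearMap.injective_iff_surjective.mp hinj (∑ i, ⁅(b i : Q), f (d i)⁆)
  exact ⟨v, fun x ↦ hinj (by rw [key f hf, hcomm, hv])⟩

/-- **Whitehead's first lemma**: every `1`-cocycle of a semisimple Lie algebra over a field of
characteristic zero with values in a finite-dimensional module is a coboundary. -/
theorem LieModule.exists_eq_lie_of_cocycle [CharZero F] [FiniteDimensional F Q]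
    [HasTrivialRadical F Q] [FiniteDimensional F V] (f : Q →ₗ[F] V)
    (hf : ∀ x y, f ⁅x, y⁆ = ⁅x, f y⁆ - ⁅y, f x⁆) : ∃ v, ∀ x, f x = ⁅x, v⁆ := by
  induction hn : finrank F V using Nat.strong_induction_on generalizing V with
  | _ n ih =>
    by_cases hirr : ∀ N : LieSubmodule F Q V, N = ⊥ ∨ N = ⊤
    · exact exists_eq_lie_of_cocycle_of_isIrreducible hirr f hf
    push Not at hirr
    obtain ⟨N, hbot, htop⟩ := hirr
    -- solve modulo `N` first, then correct inside `N`
    have hlt : finrank F (V ⧸ N) < n := by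
      have h1 := N.toSubmodule.finrank_quotient_add_finrank
      have h2 : 0 < finrank F N.toSubmodule := by
        have : Nontrivial N.toSubmodule :=
          Submodule.nontrivial_iff_ne_bot.mpr (by simpa using hbot)
        exact finrank_pos
      change finrank F (V ⧸ N.toSubmodule) < n
      omega
    have hlt' : finrank F N < n :=
      hn ▸ Submodule.finrank_lt (s := N.toSubmodule) (by simpa [lt_top_iff_ne_top] using htop)
    have : FiniteDimensional F (V ⧸ N) :=
      inferInstanceAs (FiniteDimensional F (V ⧸ N.toSubmodule))
    obtain ⟨w, hw⟩ := ih _ hlt (V := V ⧸ N)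
      ((LieSubmodule.Quotient.mk' N : V →ₗ[F] V ⧸ N) ∘ₗ f) (fun x y ↦ by
        simp only [LinearMap.comp_apply, LieModuleHom.coe_toLinearMap, hf, map_sub,
          LieModuleHom.map_lie]) rfl
    obtain ⟨w, rfl⟩ := LieSubmodule.Quotient.surjective_mk' N w
    have hmem (x : Q) : f x - ⁅x, w⁆ ∈ N := by
      rw [← LieSubmodule.Quotient.mk_eq_zero, map_sub, sub_eq_zero]
      simpa using hw x
    let g : Q →ₗ[F] N :=
      (f - (toEnd F Q V : Q →ₗ[F] V →ₗ[F] V).flip w).codRestrict N.toSubmodule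
        (fun x ↦ by simpa using hmem x)
    have hgval (x : Q) : (g x : V) = f x - ⁅x, w⁆ := rfl
    obtain ⟨u, hu⟩ := ih _ hlt' (V := N) g (fun x y ↦ by
      refine Subtype.ext ?_
      simp only [hgval, LieSubmodule.coe_sub, LieSubmodule.coe_bracket, hf, lie_lie, lie_sub]
      abel) rfl
    refine ⟨w + u, fun x ↦ ?_⟩
    have := congrArg Subtype.val (hu x)
    rw [hgval, LieSubmodule.coe_bracket, sub_eq_iff_eq_add] at this
    rw [lie_add, this, add_comm]

end Whitehead

namespace Leibniz

/-! ### Ideals and the radical of a Leibniz algebra -/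

section Ideals

variable {F L : Type*} [Field F] [NonUnitalNonAssocRing L] [Module F L]

theorem mul_mem_derivedSubspace {I : Submodule F L} {x y : L} (hx : x ∈ I) (hy : y ∈ I) :
    x * y ∈ derivedSubspace I :=
  Submodule.subset_span ⟨x, hx, y, hy, rfl⟩

theorem derivedSubspace_le {I J : Submodule F L} (h : ∀ x ∈ I, ∀ y ∈ I, x * y ∈ J) :
    derivedSubspace I ≤ J :=
  Submodule.span_le.mpr fun _ ⟨x, hx, y, hy, e⟩ ↦ e ▸ h x hx y hy

theorem IsIdeal.derivedSubspace_le_self {I : Submodule F L} (hI : IsIdeal I) :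
    derivedSubspace I ≤ I :=
  derivedSubspace_le fun x _ y hy ↦ hI.mul_mem_left x y hy

theorem derivedSubspace_mono {I J : Submodule F L} (h : I ≤ J) :
    derivedSubspace I ≤ derivedSubspace J :=
  derivedSubspace_le fun _ hx _ hy ↦ mul_mem_derivedSubspace (h hx) (h hy)

theorem derivedSeries_mono {I J : Submodule F L} (h : I ≤ J) (k : ℕ) :
    derivedSeries I k ≤ derivedSeries J k := by
  induction k with
  | zero => exact h
  | succ k ih => exact derivedSubspace_mono ih

theorem derivedSeries_add (I : Submodule F L) (k m : ℕ) :
    derivedSeries I (k + m) = derivedSeries (derivedSeries I k) m := by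
  induction m with
  | zero => rfl
  | succ m ih => exact congrArg derivedSubspace ih

theorem IsSoluble.of_derivedSeries_le {I R : Submodule F L} (hR : IsSoluble R) {k : ℕ}
    (h : derivedSeries I k ≤ R) : IsSoluble I := by
  obtain ⟨m, hm⟩ := hR
  refine ⟨k + m, ?_⟩
  rw [derivedSeries_add, eq_bot_iff, ← hm]
  exact derivedSeries_mono h m

theorem derivedSeries_sup_le (I : Submodule F L) {R : Submodule F L} (hR : IsIdeal R) (k : ℕ) :
    derivedSeries (I ⊔ R) k ≤ derivedSeries I k ⊔ R := by
  induction k with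
  | zero => exact le_rfl
  | succ k ih =>
    refine derivedSubspace_le fun x hx y hy ↦ ?_
    obtain ⟨i, hi, r, hr, rfl⟩ := Submodule.mem_sup.mp (ih hx)
    obtain ⟨j, hj, s, hs, rfl⟩ := Submodule.mem_sup.mp (ih hy)
    rw [mul_add, add_mul, add_assoc]
    exact Submodule.add_mem_sup (mul_mem_derivedSubspace hi hj)
      (R.add_mem (hR.mul_mem_right _ _ hr) (hR.mul_mem_left _ _ hs))

theorem IsSoluble.sup {I R : Submodule F L} (hI : IsSoluble I) (hR : IsSoluble R)
    (hR' : IsIdeal R) : IsSoluble (I ⊔ R) := by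
  obtain ⟨k, hk⟩ := hI
  refine hR.of_derivedSeries_le (k := k) ((derivedSeries_sup_le I hR' k).trans ?_)
  rw [hk, bot_sup_eq]

theorem IsIdeal.sup {I J : Submodule F L} (hI : IsIdeal I) (hJ : IsIdeal J) :
    IsIdeal (I ⊔ J) where
  mul_mem_left a x hx := by
    obtain ⟨i, hi, j, hj, rfl⟩ := Submodule.mem_sup.mp hx
    rw [mul_add]
    exact Submodule.add_mem_sup (hI.mul_mem_left _ _ hi) (hJ.mul_mem_left _ _ hj)
  mul_mem_right a x hx := by
    obtain ⟨i, hi, j, hj, rfl⟩ := Submodule.mem_sup.mp hx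
    rw [add_mul]
    exact Submodule.add_mem_sup (hI.mul_mem_right _ _ hi) (hJ.mul_mem_right _ _ hj)

theorem derivedSeries_map_le {L' : Type*} [NonUnitalNonAssocRing L'] [Module F L']
    (f : L →ₗ[F] L') (hf : ∀ x y, f (x * y) = f x * f y) (I : Submodule F L) (k : ℕ) :
    derivedSeries (I.map f) k ≤ (derivedSeries I k).map f := by
  induction k with
  | zero => exact le_rfl
  | succ k ih =>
    refine derivedSubspace_le fun x hx y hy ↦ ?_
    obtain ⟨x', hx', rfl⟩ := ih hx
    obtain ⟨y', hy', rfl⟩ := ih hy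
    exact ⟨x' * y', mul_mem_derivedSubspace hx' hy', hf x' y'⟩

theorem le_radical {I : Submodule F L} (hI : IsIdeal I) (hI' : IsSoluble I) :
    I ≤ radical F L :=
  le_sSup ⟨hI, hI'⟩

/-- In finite dimension a maximal soluble ideal absorbs every soluble ideal, since sums of two
soluble ideals are soluble. -/
theorem isIdeal_radical_and_isSoluble_radical [FiniteDimensional F L] :
    IsIdeal (radical F L) ∧ IsSoluble (radical F L) := by
  have hne : {I : Submodule F L | IsIdeal I ∧ IsSoluble I}.Nonempty :=
    ⟨⊥, ⟨fun a x hx ↦ by simp_all, fun a x hx ↦ by simp_all⟩, 0, rfl⟩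
  obtain ⟨M, hM, hmax⟩ := WellFounded.has_min (wellFounded_gt (α := Submodule F L)) _ hne
  have : radical F L = M := by
    refine le_antisymm (sSup_le fun I hI ↦ ?_) (le_sSup hM)
    have hsup := hmax (I ⊔ M) ⟨hI.1.sup hM.1, hI.2.sup hM.2 hM.1⟩
    have hle : M ≤ I ⊔ M := le_sup_right
    exact le_sup_left.trans (hle.eq_of_not_lt hsup).ge
  exact this ▸ hM

theorem isIdeal_span [IsScalarTower F L L] [SMulCommClass F L L] {s : Set L}
    (hl : ∀ a, ∀ x ∈ s, a * x ∈ Submodule.span F s)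
    (hr : ∀ a, ∀ x ∈ s, x * a ∈ Submodule.span F s) : IsIdeal (Submodule.span F s) where
  mul_mem_left a _ hx :=
    (Submodule.span_le (p := (Submodule.span F s).comap (LinearMap.mulLeft F a))).mpr (hl a) hx
  mul_mem_right a _ hx :=
    (Submodule.span_le (p := (Submodule.span F s).comap (LinearMap.mulRight F a))).mpr (hr a) hx

/-- A soluble ideal `I` of a complement `S` to the radical `R` gives the soluble ideal `I + R` of
the whole algebra, so `I ≤ S ∩ R = 0`. -/
theorem isSemisimple_of_isCompl_radical [FiniteDimensional F L] (S : NonUnitalSubalgebra F L)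
    (hsup : S.toSubmodule ⊔ radical F L = ⊤) (hinf : S.toSubmodule ⊓ radical F L = ⊥) :
    IsSemisimple F S := by
  obtain ⟨hR, hsol⟩ := isIdeal_radical_and_isSoluble_radical (F := F) (L := L)
  refine sSup_eq_bot.mpr fun I hI ↦ ?_
  let j : S →ₗ[F] L := S.toSubmodule.subtype
  have hj (x : S) : j x = x := rfl
  have hI' : IsSoluble (I.map j) := by
    obtain ⟨k, hk⟩ := hI.2
    refine ⟨k, eq_bot_iff.mpr ((derivedSeries_map_le j (fun _ _ ↦ rfl) I k).trans ?_)⟩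
    rw [hk, Submodule.map_bot]
  have hdecomp (a : L) : ∃ s : S, ∃ r ∈ radical F L, (s : L) + r = a := by
    obtain ⟨s, hs, r, hr, e⟩ := Submodule.mem_sup.mp (hsup ▸ Submodule.mem_top (x := a))
    exact ⟨⟨s, hs⟩, r, hr, e⟩
  have hIR : IsIdeal (I.map j ⊔ radical F L) := by
    constructor
    all_goals
      intro a x hx
      obtain ⟨_, ⟨i, hi, rfl⟩, r, hr, rfl⟩ := Submodule.mem_sup.mp hx
      obtain ⟨s, t, ht, rfl⟩ := hdecomp a
    · rw [mul_add, add_mul, add_assoc]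
      exact Submodule.add_mem_sup ⟨s * i, hI.1.mul_mem_left s i hi, rfl⟩
        (add_mem (hR.mul_mem_right _ _ ht) (hR.mul_mem_left _ _ hr))
    · rw [add_mul, mul_add, add_assoc]
      exact Submodule.add_mem_sup ⟨i * s, hI.1.mul_mem_right s i hi, rfl⟩
        (add_mem (hR.mul_mem_left _ _ ht) (hR.mul_mem_right _ _ hr))
  have hle := le_radical hIR (hI'.sup hsol hR)
  refine eq_bot_iff.mpr fun i hi ↦ ?_
  have : (i : L) ∈ S.toSubmodule ⊓ radical F L :=
    ⟨i.2, hle (Submodule.mem_sup_left ⟨i, hi, rfl⟩)⟩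
  rw [hinf] at this
  exact Subtype.ext this

variable [IsLeftLeibniz L]

theorem mul_mul_eq_sub (x y a : L) : (x * y) * a = x * (y * a) - y * (x * a) := by
  rw [IsLeftLeibniz.leibniz x y a, add_sub_cancel_right]

variable [IsScalarTower F L L] [SMulCommClass F L L]

theorem IsIdeal.derivedSubspace {I : Submodule F L} (hI : IsIdeal I) :
    IsIdeal (derivedSubspace I) := by
  refine isIdeal_span ?_ ?_
  · rintro a _ ⟨x, hx, y, hy, rfl⟩
    rw [IsLeftLeibniz.leibniz a x y]
    exact add_mem (mul_mem_derivedSubspace (hI.mul_mem_left _ _ hx) hy)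
      (mul_mem_derivedSubspace hx (hI.mul_mem_left _ _ hy))
  · rintro a _ ⟨x, hx, y, hy, rfl⟩
    rw [mul_mul_eq_sub]
    exact sub_mem (mul_mem_derivedSubspace hx (hI.mul_mem_right _ _ hy))
      (mul_mem_derivedSubspace hy (hI.mul_mem_right _ _ hx))

theorem IsIdeal.derivedSeries {I : Submodule F L} (hI : IsIdeal I) (k : ℕ) :
    IsIdeal (derivedSeries I k) := by
  induction k with
  | zero => exact hI
  | succ k ih => exact ih.derivedSubspace

/-- Squares act trivially from the left, so they span an ideal with zero multiplication. -/
theorem mul_self_mem_radical (x : L) : x * x ∈ radical F L := by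
  set K := Submodule.span F (Set.range fun x : L ↦ x * x)
  have hsq (x : L) : x * x ∈ K := Submodule.subset_span ⟨x, rfl⟩
  have hzero (x a : L) : (x * x) * a = 0 := by rw [mul_mul_eq_sub, sub_self]
  have hK : IsIdeal K := by
    refine isIdeal_span ?_ ?_
    · rintro a _ ⟨x, rfl⟩
      have : a * (x * x) = (a * x + x) * (a * x + x) - (a * x) * (a * x) - x * x := by
        rw [IsLeftLeibniz.leibniz a x x, add_mul, mul_add, mul_add]; abel
      change a * (x * x) ∈ K
      rw [this]
      exact sub_mem (sub_mem (hsq _) (hsq _)) (hsq _)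
    · rintro a _ ⟨x, rfl⟩
      simp [hzero]
  refine le_radical hK ⟨1, eq_bot_iff.mpr (derivedSubspace_le fun u hu v _ ↦ ?_)⟩ (hsq x)
  exact (Submodule.span_le (p := LinearMap.ker (LinearMap.mulRight F v))).mpr
    (by rintro _ ⟨y, rfl⟩; exact hzero y v) hu

end Ideals

/-! ### The quotient by the radical -/

section Quotient

universe u

open LieAlgebra

variable {F : Type*} {L : Type u} [Field F] [NonUnitalNonAssocRing L] [Module F L]
  [IsScalarTower F L L] [SMulCommClass F L L]

/-- The product induced on the quotient by an ideal. -/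
def quotientMul {I : Submodule F L} (hI : IsIdeal I) : L ⧸ I →ₗ[F] L ⧸ I →ₗ[F] L ⧸ I :=
  I.liftQ
    { toFun := fun x ↦ I.mapQ I (LinearMap.mulLeft F x) fun y hy ↦ hI.mul_mem_left x y hy
      map_add' := fun x y ↦ by
        ext z
        exact congrArg I.mkQ (add_mul x y z)
      map_smul' := fun r x ↦ by
        ext z
        exact congrArg I.mkQ (smul_mul_assoc r x z) }
    fun x hx ↦ LinearMap.mem_ker.mpr <| by
      ext y
      exact (Submodule.Quotient.mk_eq_zero I).mpr (hI.mul_mem_right y x hx)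

theorem quotientMul_mk {I : Submodule F L} (hI : IsIdeal I) (x y : L) :
    quotientMul hI (I.mkQ x) (I.mkQ y) = I.mkQ (x * y) :=
  rfl

variable [IsLeftLeibniz L]

/-- The quotient of a left Leibniz algebra by an ideal that contains all squares is a Lie ring. -/
abbrev quotientLieRing {I : Submodule F L} (hI : IsIdeal I) (hsq : ∀ x, x * x ∈ I) :
    LieRing (L ⧸ I) where
  bracket x y := quotientMul hI x y
  add_lie x y z := by simp
  lie_add x y z := by simp
  lie_self x := by
    obtain ⟨x, rfl⟩ := I.mkQ_surjective x
    rw [quotientMul_mk]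
    simpa using hsq x
  leibniz_lie x y z := by
    obtain ⟨x, rfl⟩ := I.mkQ_surjective x
    obtain ⟨y, rfl⟩ := I.mkQ_surjective y
    obtain ⟨z, rfl⟩ := I.mkQ_surjective z
    change quotientMul hI _ (quotientMul hI _ _) = quotientMul hI (quotientMul hI _ _) _
      + quotientMul hI _ (quotientMul hI _ _)
    simp only [quotientMul_mk, ← map_add]
    rw [IsLeftLeibniz.leibniz x y z]

variable (F L) in
/-- The quotient by the radical, presented as a surjection `p` onto a Lie algebra. A soluble ideal
of the quotient has a soluble preimage, so the quotient has trivial radical. -/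
theorem exists_lieAlgebra_quotient_radical [FiniteDimensional F L] :
    ∃ (Q : Type u) (_ : LieRing Q) (_ : LieAlgebra F Q) (p : L →ₗ[F] Q),
      FiniteDimensional F Q ∧ HasTrivialRadical F Q ∧ Function.Surjective p ∧
      LinearMap.ker p = radical F L ∧ ∀ x y, p (x * y) = ⁅p x, p y⁆ := by
  obtain ⟨hI, hsol⟩ := isIdeal_radical_and_isSoluble_radical (F := F) (L := L)
  let _ : LieRing (L ⧸ radical F L) := quotientLieRing hI mul_self_mem_radical
  let _ : LieAlgebra F (L ⧸ radical F L) :=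
    { (inferInstance : Module F (L ⧸ radical F L)) with
      lie_smul := fun r x y ↦ (quotientMul hI x).map_smul r y }
  let p : L →ₗ[F] L ⧸ radical F L := (radical F L).mkQ
  have hker : LinearMap.ker p = radical F L := Submodule.ker_mkQ _
  have hmul (x y : L) : p (x * y) = ⁅p x, p y⁆ := rfl
  have hsurj : Function.Surjective p := Submodule.mkQ_surjective _
  refine ⟨L ⧸ radical F L, inferInstance, inferInstance, p,
    inferInstanceAs (FiniteDimensional F (L ⧸ radical F L)), ?_, hsurj, hker, hmul⟩
  refine hasTrivialRadical_of_no_solvable_ideals fun J hJ ↦ ?_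
  obtain ⟨k, hk⟩ := IsSolvable.solvable F J
  rw [LieIdeal.derivedSeries_eq_bot_iff] at hk
  let P : Submodule F L := J.toSubmodule.comap p
  have hP : IsIdeal P :=
    ⟨fun a x hx ↦ by
      change p (a * x) ∈ J
      rw [hmul]
      exact lie_mem_right F _ J _ _ hx, fun a x hx ↦ by
      change p (x * a) ∈ J
      rw [hmul]
      exact lie_mem_left F _ J _ _ hx⟩
  have hder (m : ℕ) :
      derivedSeries P m ≤ (derivedSeriesOfIdeal F (L ⧸ radical F L) m J).toSubmodule.comap p := by
    induction m with
    | zero => exact le_rfl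
    | succ m ih =>
      refine derivedSubspace_le fun x hx y hy ↦ ?_
      change p (x * y) ∈ derivedSeriesOfIdeal F (L ⧸ radical F L) (m + 1) J
      rw [hmul, derivedSeriesOfIdeal_succ]
      exact LieSubmodule.lie_mem_lie (ih hx) (ih hy)
  have hPsol : IsSoluble P := by
    refine hsol.of_derivedSeries_le (k := k) ((hder k).trans ?_)
    rw [hk]
    exact hker.le
  refine (LieSubmodule.eq_bot_iff J).mpr fun q hq ↦ ?_
  obtain ⟨x, rfl⟩ := hsurj q
  have : x ∈ LinearMap.ker p := hker.ge (le_radical hP hPsol hq)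
  exact this

end Quotient

end Leibniz

/-! ### Cocycles with values in a subquotient -/

section RelativeCocycle

open Module LieAlgebra

variable {F L Q V : Type*} [Field F] [CharZero F] [NonUnitalNonAssocRing L] [Module F L]
  [LieRing Q] [LieAlgebra F Q] [FiniteDimensional F Q] [HasTrivialRadical F Q]
  [AddCommGroup V] [Module F V] [FiniteDimensional F V]

/-- Whitehead's first lemma for the subquotient `W / (W ∩ Z)` of a representation `τ` of a
nonassociative algebra `L`, where a multiplicatively closed `S` acts on it through a
surjection `p` onto a semisimple Lie algebra. The map `f` induces a cocycle with values in it. -/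
theorem exists_mem_forall_sub_mem_of_cocycle (p : L →ₗ[F] Q) (hp : ∀ x y, p (x * y) = ⁅p x, p y⁆)
    {S : Submodule F L} (hS : ∀ x ∈ S, ∀ y ∈ S, x * y ∈ S) (hpS : S.map p = ⊤)
    (τ : L →ₗ[F] V →ₗ[F] V) (hτ : ∀ x y v, τ (x * y) v = τ x (τ y v) - τ y (τ x v))
    {W Z : Submodule F V} (hW : ∀ x ∈ S, ∀ w ∈ W, τ x w ∈ W)
    (hZ : ∀ x ∈ S, ∀ z ∈ Z, τ x z ∈ Z)
    (hWZ : ∀ x ∈ S, p x = 0 → ∀ w ∈ W, τ x w ∈ Z)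
    (f : L →ₗ[F] V) (hfW : ∀ x ∈ S, f x ∈ W) (hfZ : ∀ x ∈ S, p x = 0 → f x ∈ Z)
    (hf : ∀ x ∈ S, ∀ y ∈ S, f (x * y) = τ x (f y) - τ y (f x)) :
    ∃ w ∈ W, ∀ x ∈ S, f x - τ x w ∈ Z := by
  -- a linear section of `p` with values in `S`
  obtain ⟨σ', hσ'⟩ := (p.domRestrict S).exists_rightInverse_of_surjective <| by
    rw [LinearMap.range_domRestrict, hpS]
  let σ : Q →ₗ[F] L := S.subtype ∘ₗ σ'
  have hσS (q : Q) : σ q ∈ S := (σ' q).2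
  have hpσ (q : Q) : p (σ q) = q := LinearMap.congr_fun hσ' q
  have hkS (q r : Q) : σ ⁅q, r⁆ - σ q * σ r ∈ S := sub_mem (hσS _) (hS _ (hσS q) _ (hσS r))
  have hkp (q r : Q) : p (σ ⁅q, r⁆ - σ q * σ r) = 0 := by rw [map_sub, hp, hpσ, hpσ, hpσ, sub_self]
  -- the Lie module structure on `W / (W ∩ Z)`
  let Z' : Submodule F W := Z.comap W.subtype
  let ρ (q : Q) : (W ⧸ Z') →ₗ[F] W ⧸ Z' :=
    Z'.mapQ Z' ((τ (σ q)).restrict (hW (σ q) (hσS q))) fun z hz ↦ hZ _ (hσS q) _ hz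
  have hρ (q : Q) (w : W) : ρ q (Z'.mkQ w) = Z'.mkQ ⟨τ (σ q) w, hW _ (hσS q) _ w.2⟩ := rfl
  let _ : LieRingModule Q (W ⧸ Z') :=
    { bracket := fun q m ↦ ρ q m
      add_lie := fun q r m ↦ by
        obtain ⟨w, rfl⟩ := Z'.mkQ_surjective m
        change ρ _ _ = ρ _ _ + ρ _ _
        rw [hρ, hρ, hρ, ← map_add]
        exact congrArg Z'.mkQ (Subtype.ext (by simp))
      lie_add := fun q m n ↦ map_add (ρ q) m n
      leibniz_lie := fun q r m ↦ by
        obtain ⟨w, rfl⟩ := Z'.mkQ_surjective m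
        change ρ _ (ρ _ _) = ρ _ _ + ρ _ (ρ _ _)
        rw [hρ, hρ, hρ, hρ, hρ, ← map_add, ← sub_eq_zero, ← map_sub]
        refine (Submodule.Quotient.mk_eq_zero Z').mpr ?_
        have h := hWZ _ (hkS q r) (hkp q r) w w.2
        rw [map_sub, LinearMap.sub_apply, hτ] at h
        have h' := neg_mem h
        change _ ∈ Z
        convert h' using 1
        simp only [Submodule.subtype_apply, Submodule.coe_sub, Submodule.coe_add]
        abel }
  have hlie (q : Q) (w : W) : ⁅q, Z'.mkQ w⁆ = Z'.mkQ ⟨τ (σ q) w, hW _ (hσS q) _ w.2⟩ := rfl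
  have : LieModule F Q (W ⧸ Z') :=
    { smul_lie := fun r q m ↦ by
        obtain ⟨w, rfl⟩ := Z'.mkQ_surjective m
        rw [hlie, hlie, ← map_smul]
        exact congrArg Z'.mkQ (Subtype.ext (by simp))
      lie_smul := fun r q m ↦ map_smul (ρ q) r m }
  let g : Q →ₗ[F] W ⧸ Z' := Z'.mkQ ∘ₗ (f ∘ₗ σ).codRestrict W fun q ↦ hfW _ (hσS q)
  have hg (q : Q) : g q = Z'.mkQ ⟨f (σ q), hfW _ (hσS q)⟩ := rfl
  obtain ⟨m, hm⟩ := LieModule.exists_eq_lie_of_cocycle g fun q r ↦ by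
    rw [hg, hg, hg, hlie, hlie, ← map_sub, ← sub_eq_zero, ← map_sub]
    refine (Submodule.Quotient.mk_eq_zero Z').mpr ?_
    have h := hfZ _ (hkS q r) (hkp q r)
    rwa [map_sub, hf _ (hσS q) _ (hσS r)] at h
  obtain ⟨w, rfl⟩ := Z'.mkQ_surjective m
  refine ⟨w, w.2, fun x hx ↦ ?_⟩
  have h1 : f (σ (p x)) - τ (σ (p x)) w ∈ Z := by
    have := hm (p x)
    rw [hg, hlie, ← sub_eq_zero, ← map_sub] at this
    exact (Submodule.Quotient.mk_eq_zero Z').mp this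
  have hdS : x - σ (p x) ∈ S := sub_mem hx (hσS _)
  have hdp : p (x - σ (p x)) = 0 := by rw [map_sub, hpσ, sub_self]
  have h2 := sub_mem (hfZ _ hdS hdp) (hWZ _ hdS hdp w w.2)
  have h3 := add_mem h1 h2
  simp only [map_sub, LinearMap.sub_apply] at h3
  convert h3 using 1
  abel

end RelativeCocycle

namespace Leibniz

/-! ### Splitting off the radical -/

section Splitting

open LieAlgebra

variable {F L : Type*} [Field F] [NonUnitalNonAssocRing L] [Module F L]
  [IsScalarTower F L L] [SMulCommClass F L L]

/-- The action `x ↦ [d_x, ·]` of a nonassociative algebra on its linear endomorphisms, where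
`d_x` is left multiplication by `x`. -/
def leftMulCommutator : L →ₗ[F] (L →ₗ[F] L) →ₗ[F] L →ₗ[F] L :=
  LinearMap.mk₂ F (fun x φ ↦ LinearMap.mulLeft F x ∘ₗ φ - φ ∘ₗ LinearMap.mulLeft F x)
    (fun x y φ ↦ by ext z; simp [add_mul]; abel)
    (fun r x φ ↦ by ext z; simp [smul_sub, smul_mul_assoc])
    (fun x φ ψ ↦ by ext z; simp [mul_add]; abel)
    (fun r x φ ↦ by ext z; simp [smul_sub])

theorem leftMulCommutator_apply (x : L) (φ : L →ₗ[F] L) (y : L) :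
    leftMulCommutator x φ y = x * φ y - φ (x * y) :=
  rfl

variable [IsLeftLeibniz L]

theorem leftMulCommutator_mul (x y : L) (φ : L →ₗ[F] L) :
    leftMulCommutator (x * y) φ =
      leftMulCommutator x (leftMulCommutator y φ) -
        leftMulCommutator y (leftMulCommutator x φ) := by
  ext z
  simp only [LinearMap.sub_apply, leftMulCommutator_apply, mul_mul_eq_sub, map_sub, mul_sub]
  abel

variable {Q : Type*} [CharZero F] [FiniteDimensional F L]
  [LieRing Q] [LieAlgebra F Q] [FiniteDimensional F Q] [HasTrivialRadical F Q]
  {p : L →ₗ[F] Q} {S B : Submodule F L}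

/-- Let `A = S ∩ ker p`, with `A * A ⊆ B`. There is an endomorphism `π` of `L`, restricting to a
projection of `S` onto `A` modulo `B`, whose commutator with every left multiplication `d_x`,
`x ∈ S`, agrees on `S` modulo `B` with some `d_a`, `a ∈ A`.

For an arbitrary projection `π₀` onto `A` the map `x ↦ [d_x, π₀]` induces a cocycle with values in
`W / (W ∩ Z)`, where `W` consists of the maps sending `S` to `A` and `A` to `B`, and `Z` of the maps
which agree on `S` modulo `B` with some `d_a`, `a ∈ A`; subtracting a solution of the
coboundary equation from `π₀` gives `π`. -/
theorem exists_projection_leftMulCommutator (hp : ∀ x y, p (x * y) = ⁅p x, p y⁆)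
    (hS : ∀ x ∈ S, ∀ y ∈ S, x * y ∈ S) (hpS : S.map p = ⊤) (hB : IsIdeal B)
    (hAA : ∀ a ∈ S ⊓ LinearMap.ker p, ∀ b ∈ S ⊓ LinearMap.ker p, a * b ∈ B) :
    ∃ π : L →ₗ[F] L, (∀ y ∈ S, π y ∈ S ⊓ LinearMap.ker p) ∧
      (∀ y ∈ S ⊓ LinearMap.ker p, π y - y ∈ B) ∧
      ∀ x ∈ S, ∃ a ∈ S ⊓ LinearMap.ker p, ∀ y ∈ S, leftMulCommutator x π y - a * y ∈ B := by
  set A := S ⊓ LinearMap.ker p with hA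
  have hAl {x a : L} (hx : x ∈ S) (ha : a ∈ A) : x * a ∈ A :=
    ⟨hS _ hx _ ha.1, by
      have : p a = 0 := ha.2
      rw [SetLike.mem_coe, LinearMap.mem_ker, hp, this, lie_zero]⟩
  have hAr {x a : L} (hx : x ∈ S) (ha : a ∈ A) : a * x ∈ A :=
    ⟨hS _ ha.1 _ hx, by
      have : p a = 0 := ha.2
      rw [SetLike.mem_coe, LinearMap.mem_ker, hp, this, zero_lie]⟩
  obtain ⟨g, hg⟩ := A.subtype.exists_leftInverse_of_injective A.ker_subtype
  let π₀ : L →ₗ[F] L := A.subtype ∘ₗ g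
  have hπA (y : L) : π₀ y ∈ A := (g y).2
  have hπid {y : L} (hy : y ∈ A) : π₀ y = y := congrArg Subtype.val (LinearMap.congr_fun hg ⟨y, hy⟩)
  let W : Submodule F (L →ₗ[F] L) :=
    { carrier := {φ | (∀ y ∈ S, φ y ∈ A) ∧ ∀ y ∈ A, φ y ∈ B}
      add_mem' := fun hφ hψ ↦ ⟨fun y hy ↦ add_mem (hφ.1 y hy) (hψ.1 y hy),
        fun y hy ↦ add_mem (hφ.2 y hy) (hψ.2 y hy)⟩
      zero_mem' := ⟨fun _ _ ↦ zero_mem A, fun _ _ ↦ zero_mem B⟩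
      smul_mem' := fun r φ hφ ↦ ⟨fun y hy ↦ A.smul_mem r (hφ.1 y hy),
        fun y hy ↦ B.smul_mem r (hφ.2 y hy)⟩ }
  let Z : Submodule F (L →ₗ[F] L) :=
    { carrier := {φ | ∃ a ∈ A, ∀ y ∈ S, φ y - a * y ∈ B}
      add_mem' := by
        rintro φ ψ ⟨a, ha, h⟩ ⟨b, hb, h'⟩
        refine ⟨a + b, add_mem ha hb, fun y hy ↦ ?_⟩
        rw [LinearMap.add_apply, add_mul, add_sub_add_comm]
        exact add_mem (h y hy) (h' y hy)
      zero_mem' := ⟨0, zero_mem A, fun y _ ↦ by simp⟩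
      smul_mem' := by
        rintro r φ ⟨a, ha, h⟩
        refine ⟨r • a, A.smul_mem r ha, fun y hy ↦ ?_⟩
        rw [LinearMap.smul_apply, smul_mul_assoc, ← smul_sub]
        exact B.smul_mem r (h y hy) }
  obtain ⟨w, hw, h⟩ := exists_mem_forall_sub_mem_of_cocycle (V := L →ₗ[F] L) (W := W) (Z := Z)
    p hp hS hpS leftMulCommutator leftMulCommutator_mul
    (fun x hx φ hφ ↦
      ⟨fun y hy ↦ sub_mem (hAl hx (hφ.1 y hy)) (hφ.1 _ (hS x hx y hy)),
        fun y hy ↦ sub_mem (hB.mul_mem_left x _ (hφ.2 y hy)) (hφ.2 _ (hAl hx hy))⟩)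
    (by
      -- if `φ` agrees with `d_a`, then `[d_x, φ]` agrees with `[d_x, d_a] = d_{x * a}`
      rintro x hx φ ⟨a, ha, h⟩
      refine ⟨x * a, hAl hx ha, fun y hy ↦ ?_⟩
      have h1 := hB.mul_mem_left x _ (h y hy)
      have h2 := h _ (hS x hx y hy)
      convert sub_mem h1 h2 using 1
      rw [leftMulCommutator_apply, mul_mul_eq_sub, mul_sub]
      abel)
    (fun a ha hpa φ hφ ↦ ⟨0, zero_mem A, fun y hy ↦ by
      rw [zero_mul, sub_zero]
      exact sub_mem (hAA a ⟨ha, hpa⟩ _ (hφ.1 y hy)) (hφ.2 _ (hAr hy ⟨ha, hpa⟩))⟩)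
    (leftMulCommutator.flip π₀)
    (fun x hx ↦
      ⟨fun y hy ↦ sub_mem (hAl hx (hπA y)) (hπA _), fun y hy ↦ by
        rw [LinearMap.flip_apply, leftMulCommutator_apply, hπid hy, hπid (hAl hx hy), sub_self]
        exact zero_mem B⟩)
    (fun a ha hpa ↦ ⟨-a, neg_mem ⟨ha, hpa⟩, fun y hy ↦ by
      rw [LinearMap.flip_apply, leftMulCommutator_apply, hπid (hAr hy ⟨ha, hpa⟩), neg_mul,
        sub_neg_eq_add, sub_add_cancel]
      exact hAA a ⟨ha, hpa⟩ _ (hπA y)⟩)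
    (fun x _ y _ ↦ leftMulCommutator_mul x y π₀)
  refine ⟨π₀ - w, fun y hy ↦ sub_mem (hπA y) (hw.1 y hy), fun y hy ↦ ?_, fun x hx ↦ ?_⟩
  · rw [LinearMap.sub_apply, hπid hy, sub_sub_cancel_left]
    exact neg_mem (hw.2 y hy)
  · rw [map_sub]
    exact h x hx

/-- If moreover left multiplication by `A = S ∩ ker p` maps `S` into `B`, then the vectors of `S`
killed modulo `B` by the projection form a subalgebra which meets `A` in `B`. -/
theorem exists_inf_ker_eq_of_mul_mem (hp : ∀ x y, p (x * y) = ⁅p x, p y⁆)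
    (hS : ∀ x ∈ S, ∀ y ∈ S, x * y ∈ S) (hpS : S.map p = ⊤)
    (hB : IsIdeal B) (hBA : B ≤ S ⊓ LinearMap.ker p)
    (hAS : ∀ a ∈ S ⊓ LinearMap.ker p, ∀ y ∈ S, a * y ∈ B) :
    ∃ T : Submodule F L, (∀ x ∈ T, ∀ y ∈ T, x * y ∈ T) ∧ T.map p = ⊤ ∧
      T ⊓ LinearMap.ker p = B := by
  obtain ⟨π, hπS, hπA, hπ⟩ := exists_projection_leftMulCommutator hp hS hpS hB
    fun a ha b hb ↦ hAS a ha b hb.1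
  refine ⟨S ⊓ B.comap π, fun x hx y hy ↦ ⟨hS _ hx.1 _ hy.1, ?_⟩, ?_, le_antisymm ?_ ?_⟩
  · obtain ⟨a, ha, h⟩ := hπ x hx.1
    have h1 := h y hy.1
    rw [leftMulCommutator_apply] at h1
    have h2 := sub_mem (sub_mem (hB.mul_mem_left x _ hy.2) h1) (hAS a ha y hy.1)
    rw [SetLike.mem_coe, Submodule.mem_comap]
    convert h2 using 1
    abel
  · refine eq_top_iff.mpr fun q _ ↦ ?_
    obtain ⟨y, hy, rfl⟩ : q ∈ S.map p := hpS ▸ Submodule.mem_top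
    have hpπ : p (π y) = 0 := (hπS y hy).2
    refine ⟨y - π y, ⟨sub_mem hy (hπS y hy).1, ?_⟩, by rw [map_sub, hpπ, sub_zero]⟩
    have := neg_mem (hπA _ (hπS y hy))
    rw [SetLike.mem_coe, Submodule.mem_comap, map_sub]
    rwa [neg_sub] at this
  · rintro y ⟨⟨hyS, hyB⟩, hyp⟩
    have h := sub_mem (show π y ∈ B from hyB) (hπA y ⟨hyS, hyp⟩)
    rwa [sub_sub_cancel] at h
  · intro y hy
    refine ⟨⟨(hBA hy).1, ?_⟩, (hBA hy).2⟩
    have := add_mem (hπA y (hBA hy)) hy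
    rwa [sub_add_cancel] at this

/-- The elements `x` of `S` whose left multiplication commutes with the projection modulo `B` form
a subalgebra, which still maps onto `Q` and whose intersection with `A = S ∩ ker p` consists of the
`a` with `a * S ⊆ B`; this reduces the splitting to `exists_inf_ker_eq_of_mul_mem`. -/
theorem exists_inf_ker_eq (hp : ∀ x y, p (x * y) = ⁅p x, p y⁆)
    (hS : ∀ x ∈ S, ∀ y ∈ S, x * y ∈ S) (hpS : S.map p = ⊤)
    (hB : IsIdeal B) (hBA : B ≤ S ⊓ LinearMap.ker p)
    (hAA : ∀ a ∈ S ⊓ LinearMap.ker p, ∀ b ∈ S ⊓ LinearMap.ker p, a * b ∈ B) :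
    ∃ T : Submodule F L, (∀ x ∈ T, ∀ y ∈ T, x * y ∈ T) ∧ T.map p = ⊤ ∧
      T ⊓ LinearMap.ker p = B := by
  obtain ⟨π, hπS, hπA, hπ⟩ := exists_projection_leftMulCommutator hp hS hpS hB hAA
  -- on `S` modulo `B`, `[d_a, π] = -d_a` for `a ∈ A`
  have hcomm (a : L) (ha : a ∈ S ⊓ LinearMap.ker p) (y : L) (hy : y ∈ S) :
      leftMulCommutator a π y + a * y ∈ B := by
    have hay : a * y ∈ S ⊓ LinearMap.ker p := by
      refine ⟨hS _ ha.1 _ hy, ?_⟩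
      have : p a = 0 := ha.2
      rw [SetLike.mem_coe, LinearMap.mem_ker, hp, this, zero_lie]
    have h := sub_mem (hAA a ha _ (hπS y hy)) (hπA _ hay)
    convert h using 1
    rw [leftMulCommutator_apply]
    abel
  let T : Submodule F L :=
    { carrier := {x | x ∈ S ∧ ∀ y ∈ S, leftMulCommutator x π y ∈ B}
      add_mem' := fun {x x'} hx hx' ↦ ⟨add_mem hx.1 hx'.1, fun y hy ↦ by
        rw [map_add]
        exact add_mem (hx.2 y hy) (hx'.2 y hy)⟩
      zero_mem' := ⟨zero_mem S, fun y _ ↦ by simp⟩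
      smul_mem' := fun r x hx ↦ ⟨S.smul_mem r hx.1, fun y hy ↦ by
        rw [map_smul]
        exact B.smul_mem r (hx.2 y hy)⟩ }
  refine exists_inf_ker_eq_of_mul_mem (S := T) hp ?_ ?_ hB ?_ ?_
  · rintro x ⟨hx, hx'⟩ y ⟨hy, hy'⟩
    refine ⟨hS x hx y hy, fun z hz ↦ ?_⟩
    rw [leftMulCommutator_mul, LinearMap.sub_apply, leftMulCommutator_apply,
      leftMulCommutator_apply y]
    exact sub_mem (sub_mem (hB.mul_mem_left x _ (hy' z hz)) (hy' _ (hS x hx z hz)))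
      (sub_mem (hB.mul_mem_left y _ (hx' z hz)) (hx' _ (hS y hy z hz)))
  · refine eq_top_iff.mpr fun q _ ↦ ?_
    obtain ⟨x, hx, rfl⟩ : q ∈ S.map p := hpS ▸ Submodule.mem_top
    obtain ⟨a, ha, h⟩ := hπ x hx
    have hpa : p a = 0 := ha.2
    refine ⟨x + a, ⟨add_mem hx ha.1, fun y hy ↦ ?_⟩, by rw [map_add, hpa, add_zero]⟩
    have h1 := add_mem (h y hy) (hcomm a ha y hy)
    rw [map_add, LinearMap.add_apply, LinearMap.add_apply]
    convert h1 using 1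
    abel
  · intro b hb
    refine ⟨⟨(hBA hb).1, fun y hy ↦ ?_⟩, (hBA hb).2⟩
    have := sub_mem (hcomm b (hBA hb) y hy) (hB.mul_mem_right y b hb)
    rwa [add_sub_cancel_right] at this
  · rintro a ⟨⟨haS, haT⟩, hap⟩ y ⟨hy, -⟩
    have := sub_mem (hcomm a ⟨haS, hap⟩ y hy) (haT y hy)
    rwa [add_sub_cancel_left] at this

/-- Descending along the derived series of `ker p` gives subalgebras mapping onto `Q` whose
intersection with `ker p` is any prescribed term of the series. -/
theorem exists_inf_ker_eq_derivedSeries (hp : ∀ x y, p (x * y) = ⁅p x, p y⁆)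
    (hsurj : Function.Surjective p) (k : ℕ) :
    ∃ T : Submodule F L, (∀ x ∈ T, ∀ y ∈ T, x * y ∈ T) ∧ T.map p = ⊤ ∧
      T ⊓ LinearMap.ker p = derivedSeries (LinearMap.ker p) k := by
  have hker : IsIdeal (LinearMap.ker p) :=
    ⟨fun a x hx ↦ by rw [LinearMap.mem_ker] at hx ⊢; rw [hp, hx, lie_zero],
      fun a x hx ↦ by rw [LinearMap.mem_ker] at hx ⊢; rw [hp, hx, zero_lie]⟩
  induction k with
  | zero =>
    exact ⟨⊤, fun _ _ _ _ ↦ Submodule.mem_top,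
      by rw [Submodule.map_top, LinearMap.range_eq_top.mpr hsurj], top_inf_eq _⟩
  | succ k ih =>
    obtain ⟨S, hS, hpS, hSA⟩ := ih
    refine exists_inf_ker_eq hp hS hpS (hker.derivedSeries (k + 1)) ?_ ?_
    · rw [hSA]
      exact (hker.derivedSeries k).derivedSubspace_le_self
    · rw [hSA]
      exact fun a ha b hb ↦ mul_mem_derivedSubspace ha hb

end Splitting

end Leibniz

theorem mainTheorem1 {F L : Type*} [Field F] [CharZero F]
    [NonUnitalNonAssocRing L] [Module F L] [IsScalarTower F L L] [SMulCommClass F L L]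
    [IsLeftLeibniz L] [FiniteDimensional F L] :
    ∃ S : NonUnitalSubalgebra F L,
      Leibniz.IsSemisimple F S ∧
      S.toSubmodule ⊔ Leibniz.radical F L = ⊤ ∧
      S.toSubmodule ⊓ Leibniz.radical F L = ⊥ := by
  obtain ⟨Q, _, _, p, _, _, hsurj, hker, hp⟩ := Leibniz.exists_lieAlgebra_quotient_radical F L
  obtain ⟨k, hk⟩ := (Leibniz.isIdeal_radical_and_isSoluble_radical (F := F) (L := L)).2
  obtain ⟨T, hT, hpT, hinf⟩ := Leibniz.exists_inf_ker_eq_derivedSeries hp hsurj k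
  rw [hker, hk] at hinf
  have hsup : T ⊔ Leibniz.radical F L = ⊤ := by
    rw [← hker, ← Submodule.comap_map_eq, hpT, Submodule.comap_top]
  let S : NonUnitalSubalgebra F L := { T with mul_mem' := fun hx hy ↦ hT _ hx _ hy }
  exact ⟨S, Leibniz.isSemisimple_of_isCompl_radical S hsup hinf, hsup, hinf⟩
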